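/- **Conventions.** $A\subseteq^* B$ means that $A\setminus B$ is finite, and $[S]^\omega$ denotes the family of all countably infinite subsets of $S$. For $f,g:\omega\to\omega$, $f\le^* g$ means that $f(n)\le g(n)$ for all but finitely many $n$. The bounding number $\mathfrak b$ is the least cardinality of an unbounded family in $(\omega^\omega,\le^*)$, and the dominating number $\mathfrak d$ is the least cardinality of a dominating family in $(\omega^\omega,\le^*)$. For an ideal $\mathcal I$ on a set $X$ put $$\mathrm{add}_\omega(\mathcal I)=\min\{|\mathcal A|:\mathcal A\subseteq\mathcal I\ \wedge\ \neg\exists\mathcal B\in[\mathcal I]^\omega\ \forall A\in\mathcal A\ \exists B\in\mathcal B\ (A\subseteq^* B)\},$$ $$\mathrm{non}_\omega(\mathcal I)=\min\{|\mathcal A|:\mathcal A\subseteq[X]^\omega\cap\mathcal I\ \wedge\ \forall\mathcal B\in[\mathcal I]^\omega\ \exists A\in\mathcal A\ \forall B\in\mathcal B\ (|A\cap B|<\aleph_0)\},$$ $$\mathrm{cof}_\omega(\mathcal I)=\min\{|\mathcal A|:\mathcal A\subseteq[\mathcal I]^\omega\ \wedge\ \forall\mathcal B\in[\mathcal I]^\omega\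 \exists\mathcal C\in\mathcal A\ \forall B\in\mathcal B\ \exists A\in\mathcal C\ (B\subseteq^* A)\},$$ with the convention $\min\emptyset=\mathfrak c^+$. Let $\{\emptyset\}\otimes\mathrm{FIN}$ be the ideal on $\omega\times\omega$ of all sets $A$ such that $\{j:(i,j)\in A\}$ is finite for every $i\in\omega$. For a countable ordinal $\alpha\ge 2$ let $\mathrm{conv}_\alpha$ be the ideal on $\omega^\alpha+1=\{\xi:\xi\le\omega^\alpha\}$ (ordinal exponentiation, order topology) of all sets that can be covered by the ranges of finitely many convergent sequences in $\omega^\alpha+1$. **Statement.** 1. $\mathrm{add}_\omega(\{\emptyset\}\otimes\mathrm{FIN})=\mathfrak b$ and $\mathrm{cof}_\omega(\{\emptyset\}\otimes\mathrm{FIN})=\mathrm{non}_\omega(\{\emptyset\}\otimes\mathrm{FIN})=\mathfrak d$. 2. For every countable ordinal $\alpha\ge 2$, $\mathrm{add}_\omega(\mathrm{conv}_\alpha)=\mathfrak b$ and $\mathrm{cof}_\omega(\mathrm{conv}_\alpha)=\mathrm{non}_\omega(\mathrm{conv}_\alpha)=\mathfrak d$. -/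

import Mathlib

open Filter Topology Set
open scoped Cardinal Ordinal

universe u

noncomputable section

/-- `f ≤* g`: there is `k` with `f n ≤ g n` for all `n ≥ k`. -/
def LEStar (f g : ℕ → ℕ) : Prop := ∃ k : ℕ, ∀ n, k ≤ n → f n ≤ g n

/-- `A ⊆* B`: the set `A \ B` is finite. -/
def SubsetStar {X : Type*} (A B : Set X) : Prop := (A \ B).Finite

/-- `[S]^ω`: the family of all countably infinite subsets of `S`. -/
def ctblInfSubsets {X : Type*} (S : Set X) : Set (Set X) :=
  {A | A ⊆ S ∧ A.Countable ∧ A.Infinite}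

/-- The bounding number `𝔟`: the least cardinality of an unbounded family in `(ω^ω, ≤*)`. -/
def boundingNumber : Cardinal.{0} :=
  sInf {κ | ∃ F : Set (ℕ → ℕ), #F = κ ∧ ¬ ∃ g : ℕ → ℕ, ∀ f ∈ F, LEStar f g}

/-- The dominating number `𝔡`: the least cardinality of a dominating family in `(ω^ω, ≤*)`. -/
def dominatingNumber : Cardinal.{0} :=
  sInf {κ | ∃ F : Set (ℕ → ℕ), #F = κ ∧ ∀ g : ℕ → ℕ, ∃ f ∈ F, LEStar g f}

open Classical in
/-- The minimum of a set of cardinals, with the convention `min ∅ = 𝔠⁺`. -/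
def minCard (S : Set Cardinal.{u}) : Cardinal.{u} :=
  if S.Nonempty then sInf S else Order.succ Cardinal.continuum

/-- The `ω`-additivity `add_ω(I)` of an ideal `I` on `X`. -/
def addOmega {X : Type u} (I : Set (Set X)) : Cardinal.{u} :=
  minCard {κ | ∃ 𝒜 : Set (Set X), #𝒜 = κ ∧ 𝒜 ⊆ I ∧
    ¬ ∃ ℬ ∈ ctblInfSubsets I, ∀ A ∈ 𝒜, ∃ B ∈ ℬ, SubsetStar A B}

/-- The `ω`-uniformity `non_ω(I)` of an ideal `I` on `X`. -/
def nonOmega {X : Type u} (I : Set (Set X)) : Cardinal.{u} :=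
  minCard {κ | ∃ 𝒜 : Set (Set X), #𝒜 = κ ∧ 𝒜 ⊆ ctblInfSubsets (univ : Set X) ∩ I ∧
    ∀ ℬ ∈ ctblInfSubsets I, ∃ A ∈ 𝒜, ∀ B ∈ ℬ, (A ∩ B).Finite}

/-- The `ω`-cofinality `cof_ω(I)` of an ideal `I` on `X`. -/
def cofOmega {X : Type u} (I : Set (Set X)) : Cardinal.{u} :=
  minCard {κ | ∃ 𝒜 : Set (Set (Set X)), #𝒜 = κ ∧ 𝒜 ⊆ ctblInfSubsets I ∧
    ∀ ℬ ∈ ctblInfSubsets I, ∃ C ∈ 𝒜, ∀ B ∈ ℬ, ∃ A ∈ C, SubsetStar B A}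

/-- The ideal `{∅} ⊗ FIN` on `ω × ω`. -/
def emptyTensorFin : Set (Set (ℕ × ℕ)) :=
  {A | ∀ i : ℕ, {j : ℕ | (i, j) ∈ A}.Finite}

/-- The ideal `conv(D)` for a subset `D` of a topological space `X`: all `A ⊆ D` that can be covered
by the ranges of finitely many sequences in `D` that converge in `X`. -/
def convIdeal {X : Type*} [TopologicalSpace X] (D : Set X) : Set (Set X) :=
  {A | A ⊆ D ∧ ∃ (k : ℕ) (d : Fin k → ℕ → X),
    (∀ i n, d i n ∈ D) ∧ (∀ i, ∃ x : X, Tendsto (d i) atTop (𝓝 x)) ∧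
    A ⊆ ⋃ i, range (d i)}

/-- The space `ω^α + 1 = {ξ : ξ ≤ ω^α}`. Its topology is the one induced from the ordinals, which
is its order topology. -/
abbrev OmegaPowSucc (α : Ordinal.{0}) : Type 1 := Iic ((ω : Ordinal.{0}) ^ α)

/-- The topology on `ω^α + 1` is the order topology. -/
theorem orderTopology_omegaPowSucc (α : Ordinal.{0}) : OrderTopology (OmegaPowSucc α) :=
  inferInstance

/-- The ideal `conv_α = conv(ω^α + 1)`. -/
def convAlpha (α : Ordinal.{0}) : Set (Set (OmegaPowSucc α)) :=
  convIdeal (univ : Set (OmegaPowSucc α))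

end

/-!
Both ideals consist of the sets converging to some member of a countable family of countably
generated filters: `{∅} ⊗ FIN` comes from the filter generated by the complements of the first `n`
columns, and the convergence ideal of a first countable, countable Hausdorff space from the
neighbourhood filters of finite sets. On a countable set `X`, the sets converging to such a filter
have a cofinal family indexed monotonically by `ω^ω`, and an infinite set `A` converging to it
yields a function `φ` with `g ≤* φ` for every monotone `g` whose set in that family meets `A` in a
finite set. This gives `𝔟 ≤ add_ω`, `cof_ω ≤ 𝔡` and `𝔡 ≤ non_ω`.

The reverse inequalities hold for every ideal that contains a copy of `{∅} ⊗ FIN` and whose members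
are finite on almost all columns of the copy: subgraphs of functions witness `add_ω ≤ 𝔟` and
`𝔡 ≤ cof_ω`, graphs witness `non_ω ≤ 𝔡`. In a space such a copy exists around any point `z` of
the second derived set, with columns converging to distinct points `q i` that converge to `z`; in
`ω ^ α + 1` with `α ≥ 2` one may take `z = ω ^ 2`.
-/

/-! ### Bounding and dominating families -/

theorem leStar_iff_eventually_le {f g : ℕ → ℕ} : LEStar f g ↔ ∀ᶠ n in atTop, f n ≤ g n :=
  eventually_atTop.symm

theorem LEStar.trans {f g h : ℕ → ℕ} (hfg : LEStar f g) (hgh : LEStar g h) : LEStar f h := by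
  rw [leStar_iff_eventually_le] at *
  filter_upwards [hfg, hgh] with n using le_trans

theorem LEStar.of_le {f g : ℕ → ℕ} (h : f ≤ g) : LEStar f g :=
  ⟨0, fun n _ => h n⟩

theorem not_leStar_add_one (g : ℕ → ℕ) : ¬ LEStar (fun n => g n + 1) g :=
  fun ⟨k, hk⟩ => Nat.not_succ_le_self _ (hk k le_rfl)

theorem exists_leStar_of_countable {ι : Type*} [Countable ι] (f : ι → ℕ → ℕ) :
    ∃ g : ℕ → ℕ, ∀ i, LEStar (f i) g := by
  obtain ⟨e, he⟩ := exists_injective_nat ι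
  have hfin : ∀ n, {i | e i ≤ n}.Finite := fun n => (finite_Iic n).preimage he.injOn
  refine ⟨fun n => (hfin n).toFinset.sup fun i => f i n, fun i => ⟨e i, fun n hn => ?_⟩⟩
  exact Finset.le_sup (f := fun i => f i n) ((hfin n).mem_toFinset.2 hn)

theorem exists_unbounded_family :
    ∃ F : Set (ℕ → ℕ), #F = boundingNumber ∧ ¬ ∃ g : ℕ → ℕ, ∀ f ∈ F, LEStar f g :=
  csInf_mem (s := {κ | ∃ F : Set (ℕ → ℕ), #F = κ ∧ ¬ ∃ g : ℕ → ℕ, ∀ f ∈ F, LEStar f g})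
    ⟨_, univ, rfl, fun ⟨g, hg⟩ => not_leStar_add_one g (hg _ (mem_univ _))⟩

theorem exists_dominating_family :
    ∃ F : Set (ℕ → ℕ), #F = dominatingNumber ∧ ∀ g : ℕ → ℕ, ∃ f ∈ F, LEStar g f :=
  csInf_mem (s := {κ | ∃ F : Set (ℕ → ℕ), #F = κ ∧ ∀ g : ℕ → ℕ, ∃ f ∈ F, LEStar g f})
    ⟨_, univ, rfl, fun g => ⟨g, mem_univ _, .of_le le_rfl⟩⟩

theorem lift_mk_range_le {ι : Type u} {Y : Type} (f : ι → Y) :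
    Cardinal.lift.{u} #(range f) ≤ #ι := by
  simpa only [Cardinal.lift_id'.{0, u}] using Cardinal.mk_range_le_lift (f := f)

theorem lift_boundingNumber_le {ι : Type u} (f : ι → ℕ → ℕ)
    (hf : ¬ ∃ g : ℕ → ℕ, ∀ i, LEStar (f i) g) : Cardinal.lift.{u} boundingNumber ≤ #ι :=
  have h : boundingNumber ≤ #(range f) :=
    csInf_le' ⟨range f, rfl, by simpa only [forall_mem_range] using hf⟩
  (Cardinal.lift_le.2 h).trans (lift_mk_range_le f)

theorem lift_dominatingNumber_le {ι : Type u} (f : ι → ℕ → ℕ)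
    (hf : ∀ g : ℕ → ℕ, ∃ i, LEStar g (f i)) : Cardinal.lift.{u} dominatingNumber ≤ #ι :=
  have h : dominatingNumber ≤ #(range f) :=
    csInf_le' ⟨range f, rfl, by simpa only [exists_range_iff] using hf⟩
  (Cardinal.lift_le.2 h).trans (lift_mk_range_le f)

theorem mk_image_le_lift {Y : Type u} (φ : (ℕ → ℕ) → Y) (F : Set (ℕ → ℕ)) :
    #(φ '' F) ≤ Cardinal.lift.{u} #F := by
  simpa only [Cardinal.lift_id'.{0, u}] using Cardinal.mk_image_le_lift (f := φ) (s := F)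

theorem mk_family_le_continuum (F : Set (ℕ → ℕ)) : #F ≤ Cardinal.continuum := by
  simpa using Cardinal.mk_set_le F

theorem boundingNumber_le_continuum : boundingNumber ≤ Cardinal.continuum := by
  obtain ⟨F, hF, -⟩ := exists_unbounded_family
  exact hF ▸ mk_family_le_continuum F

theorem dominatingNumber_le_continuum : dominatingNumber ≤ Cardinal.continuum := by
  obtain ⟨F, hF, -⟩ := exists_dominating_family
  exact hF ▸ mk_family_le_continuum F

theorem minCard_le {S : Set Cardinal.{u}} {μ κ : Cardinal.{u}} (hμ : μ ∈ S) (h : μ ≤ κ) :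
    minCard S ≤ κ := by
  rw [minCard, if_pos ⟨μ, hμ⟩]
  exact (csInf_le' hμ).trans h

theorem lift_le_minCard {S : Set Cardinal.{u}} {κ : Cardinal.{0}} (hκ : κ ≤ Cardinal.continuum)
    (h : ∀ μ ∈ S, Cardinal.lift.{u} κ ≤ μ) : Cardinal.lift.{u} κ ≤ minCard S := by
  unfold minCard
  split_ifs with hS
  · exact le_csInf hS h
  · exact (Cardinal.lift_le_continuum.2 hκ).trans (Order.le_succ _)

theorem exists_ctblInf_superset {X : Type*} {I D : Set (Set X)} (hI : I.Infinite) (hD : D ⊆ I)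
    (hc : D.Countable) : ∃ ℬ ∈ ctblInfSubsets I, D ⊆ ℬ := by
  let e : ℕ → Set X := fun n => hI.natEmbedding I n
  have he : Function.Injective e := Subtype.val_injective.comp (hI.natEmbedding I).injective
  have heI : range e ⊆ I := range_subset_iff.2 fun n => (hI.natEmbedding I n).2
  exact ⟨D ∪ range e, ⟨union_subset hD heI, hc.union (countable_range e),
    (infinite_range_of_injective he).mono subset_union_right⟩, subset_union_left⟩

theorem SubsetStar.mono {X : Type*} {A A' B B' : Set X} (h : SubsetStar A B) (hA : A' ⊆ A)
    (hB : B ⊆ B') : SubsetStar A' B' :=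
  h.subset (sdiff_subset_sdiff hA hB)

/-! ### Sets converging to a filter -/

/-- The set `A` converges to the filter `F` if every member of `F` contains all but finitely many
points of `A`. For a countably infinite `A` this says that some, equivalently any, injective
enumeration of `A` tends to `F`. -/
def SetConvergesTo {X : Type*} (A : Set X) (F : Filter X) : Prop :=
  cofinite ⊓ 𝓟 A ≤ F

/-- The family of all sets that converge to one of the filters `F i`. Both `{∅} ⊗ FIN` and the
convergence ideal of a countable Hausdorff space are of this form. -/
def setsConvergingTo {X ι : Type*} (F : ι → Filter X) : Set (Set X) :=
  {A | ∃ i, SetConvergesTo A (F i)}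

theorem setConvergesTo_iff {X : Type*} {A : Set X} {F : Filter X} :
    SetConvergesTo A F ↔ ∀ U ∈ F, (A \ U).Finite := by
  refine forall₂_congr fun U _ => ?_
  rw [mem_inf_principal', mem_cofinite, compl_union, compl_compl, sdiff_eq]

theorem setConvergesTo_of_finite {X : Type*} {A : Set X} (hA : A.Finite) (F : Filter X) :
    SetConvergesTo A F :=
  setConvergesTo_iff.2 fun _ _ => hA.sdiff

namespace SetConvergesTo

variable {X Y : Type*} {A B : Set X} {F G : Filter X}

theorem mono (hA : SetConvergesTo A F) (hBA : B ⊆ A) : SetConvergesTo B F :=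
  (inf_le_inf_left _ (principal_mono.2 hBA)).trans hA

theorem mono_right (hA : SetConvergesTo A F) (hFG : F ≤ G) : SetConvergesTo A G :=
  le_trans hA hFG

theorem union (hA : SetConvergesTo A F) (hB : SetConvergesTo B F) : SetConvergesTo (A ∪ B) F := by
  rw [SetConvergesTo, ← sup_principal, inf_sup_left]
  exact sup_le hA hB

theorem image {G : Filter Y} {p : X → Y} (hA : SetConvergesTo A F) (hp : Tendsto p F G) :
    SetConvergesTo (p '' A) G := by
  refine setConvergesTo_iff.2 fun U hU => ?_
  rw [← image_sdiff_preimage]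
  exact (setConvergesTo_iff.1 hA _ (hp hU)).image p

theorem tendsto (hA : SetConvergesTo A F) {q : Y → X} (hq : Function.Injective q)
    (hqA : ∀ y, q y ∈ A) : Tendsto q cofinite F :=
  (tendsto_inf.2 ⟨hq.tendsto_cofinite, tendsto_principal.2 (.of_forall hqA)⟩).mono_right hA

theorem inter_finite (hA : SetConvergesTo A F) (hB : SetConvergesTo B G) (hFG : Disjoint F G) :
    (A ∩ B).Finite := by
  have h : Disjoint (cofinite ⊓ 𝓟 A) (cofinite ⊓ 𝓟 B) := hFG.mono hA hB
  rwa [disjoint_iff, ← inf_inf_distrib_left, inf_principal, inf_principal_eq_bot, mem_cofinite,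
    compl_compl] at h

theorem exists_eq_union (hA : SetConvergesTo A (F ⊔ G)) (hFG : Disjoint F G) :
    ∃ B C, A = B ∪ C ∧ SetConvergesTo B F ∧ SetConvergesTo C G := by
  obtain ⟨U, hU, V, hV, hUV⟩ := Filter.disjoint_iff.1 hFG
  refine ⟨A ∩ U, A \ U, (inter_union_sdiff A U).symm, setConvergesTo_iff.2 fun W hW => ?_,
    setConvergesTo_iff.2 fun W hW => ?_⟩
  · refine (setConvergesTo_iff.1 hA (W ∪ V) ?_).subset ?_
    · exact mem_sup.2 ⟨mem_of_superset hW subset_union_left, mem_of_superset hV subset_union_right⟩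
    · rintro x ⟨⟨hxA, hxU⟩, hxW⟩
      exact ⟨hxA, not_or.2 ⟨hxW, disjoint_left.1 hUV hxU⟩⟩
  · refine (setConvergesTo_iff.1 hA (W ∪ U) ?_).subset ?_
    · exact mem_sup.2 ⟨mem_of_superset hU subset_union_right, mem_of_superset hW subset_union_left⟩
    · rintro x ⟨⟨hxA, hxU⟩, hxW⟩
      exact ⟨hxA, not_or.2 ⟨hxW, hxU⟩⟩

end SetConvergesTo

theorem setConvergesTo_range {X : Type*} {F : Filter X} {u : ℕ → X} (hu : Tendsto u atTop F) :
    SetConvergesTo (range u) F := by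
  rw [← image_univ]
  refine SetConvergesTo.image (F := atTop) ?_ hu
  rw [SetConvergesTo, principal_univ, inf_top_eq, Nat.cofinite_eq_atTop]

theorem exists_infinite_setConvergesTo {X : Type*} {F : Filter X} [F.NeBot]
    [F.IsCountablyGenerated] (hF : F ≤ cofinite) {S : Set X} (hS : S ∈ F) :
    ∃ A ⊆ S, A.Infinite ∧ SetConvergesTo A F := by
  obtain ⟨u, hu⟩ := F.exists_seq_tendsto
  refine ⟨range u ∩ S, inter_subset_right, fun hfin => ?_,
    (setConvergesTo_range hu).mono inter_subset_left⟩
  have hmem : ∀ᶠ n in atTop, u n ∈ range u ∩ S :=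
    (hu.eventually hS).mono fun n hn => ⟨mem_range_self n, hn⟩
  have hnot : ∀ᶠ n in atTop, u n ∉ range u ∩ S :=
    (hu.mono_right hF).eventually hfin.compl_mem_cofinite
  obtain ⟨n, hn, hn'⟩ := (hmem.and hnot).exists
  exact hn' hn

/-! ### Cofinal families of convergent sets -/

/-- For an enumeration `e` of `X` and a sequence of sets `U`, the set of points `y` with
`e y ≤ f n` whenever `y ∉ U n`. If `U` is a decreasing basis of a filter, these sets are cofinal
among the sets converging to that filter. -/
def graphSet {X : Type*} (e : X → ℕ) (U : ℕ → Set X) (f : ℕ → ℕ) : Set X :=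
  {y | ∀ n, y ∉ U n → e y ≤ f n}

section GraphSet

variable {X : Type*} {e : X → ℕ} {U : ℕ → Set X} {F : Filter X} {A : Set X}

theorem setConvergesTo_graphSet (he : Function.Injective e) (hU : F.HasAntitoneBasis U)
    (f : ℕ → ℕ) : SetConvergesTo (graphSet e U f) F := by
  refine setConvergesTo_iff.2 fun V hV => ?_
  obtain ⟨n, hn⟩ := hU.mem_iff.1 hV
  exact ((finite_Iic (f n)).preimage he.injOn).subset fun y hy => hy.1 n fun h => hy.2 (hn h)

theorem subsetStar_graphSet (he : Function.Injective e) {f g : ℕ → ℕ} (hfg : LEStar f g) :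
    SubsetStar (graphSet e U f) (graphSet e U g) := by
  obtain ⟨k, hk⟩ := hfg
  refine ((finite_Iic ((Finset.range k).sup f)).preimage he.injOn).subset fun y hy => ?_
  obtain ⟨n, hn, hgn⟩ : ∃ n, y ∉ U n ∧ g n < e y := by simpa [graphSet] using hy.2
  have hnk : n < k := not_le.1 fun h => ((hy.1 n hn).trans (hk n h)).not_gt hgn
  exact (hy.1 n hn).trans (Finset.le_sup (Finset.mem_range.2 hnk))

theorem SetConvergesTo.exists_subset_graphSet (hA : SetConvergesTo A F)
    (hU : ∀ n, U n ∈ F) (e : X → ℕ) : ∃ f, A ⊆ graphSet e U f := by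
  have hbdd : ∀ n, BddAbove (e '' (A \ U n)) := fun n =>
    ((setConvergesTo_iff.1 hA _ (hU n)).image e).bddAbove
  choose f hf using hbdd
  exact ⟨f, fun y hy n hn => hf n (mem_image_of_mem e ⟨hy, hn⟩)⟩

theorem SetConvergesTo.exists_leStar_of_inter_graphSet_finite (hA : SetConvergesTo A F)
    (hinf : A.Infinite) (he : Function.Injective e) (hU : F.HasAntitoneBasis U) :
    ∃ φ : ℕ → ℕ, ∀ g, Monotone g → (A ∩ graphSet e U g).Finite → LEStar g φ := by
  have hex : ∀ n, ∃ y ∈ A ∩ U n, n ≤ e y := by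
    intro n
    have hAU : (A ∩ U n).Infinite := fun hfin =>
      hinf (by simpa using hfin.union (setConvergesTo_iff.1 hA _ (hU.mem n)))
    by_contra! hlt
    exact hAU (((finite_Iio n).preimage he.injOn).subset hlt)
  choose y hy hny using hex
  refine ⟨fun n => e (y n), fun g hg hfin => ?_⟩
  obtain ⟨M, hM⟩ := (hfin.image e).bddAbove
  refine ⟨M + 1, fun n hn => ?_⟩
  have hyn : y n ∉ graphSet e U g := fun h =>
    (hn.trans (hny n)).not_gt (Nat.lt_succ_of_le (hM (mem_image_of_mem e ⟨(hy n).1, h⟩)))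
  obtain ⟨m, hm, hgm⟩ : ∃ m, y n ∉ U m ∧ g m < e (y n) := by simpa [graphSet] using hyn
  have hnm : n ≤ m := (not_le.1 fun h => hm (hU.antitone h (hy n).2)).le
  exact (hg hnm).trans hgm.le

end GraphSet

section SetsConvergingTo

variable {X : Type u} {ι : Type*} {F : ι → Filter X}

theorem infinite_setsConvergingTo [Infinite X] [Nonempty ι] : (setsConvergingTo F).Infinite :=
  (infinite_range_of_injective singleton_injective).mono <| range_subset_iff.2 fun x =>
    ⟨Classical.arbitrary ι, setConvergesTo_of_finite (finite_singleton x) _⟩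

theorem exists_ctblInf_graphSet_mem [Infinite X] [Nonempty ι] [Countable ι] {e : X → ℕ}
    (he : Function.Injective e) {U : ι → ℕ → Set X} (hU : ∀ i, (F i).HasAntitoneBasis (U i))
    (f : ℕ → ℕ) : ∃ ℬ ∈ ctblInfSubsets (setsConvergingTo F), ∀ i, graphSet e (U i) f ∈ ℬ := by
  obtain ⟨ℬ, hℬ, hsub⟩ := exists_ctblInf_superset (infinite_setsConvergingTo (F := F))
    (range_subset_iff.2 fun i => ⟨i, setConvergesTo_graphSet he (hU i) f⟩)
    (countable_range fun i => graphSet e (U i) f)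
  exact ⟨ℬ, hℬ, fun i => hsub (mem_range_self i)⟩

variable [Countable X] [Infinite X] [Countable ι] [Nonempty ι] [∀ i, (F i).IsCountablyGenerated]

theorem lift_boundingNumber_le_addOmega :
    Cardinal.lift.{u} boundingNumber ≤ addOmega (setsConvergingTo F) := by
  obtain ⟨e, he⟩ := exists_injective_nat X
  choose U hU using fun i => (F i).exists_antitone_basis
  refine lift_le_minCard boundingNumber_le_continuum ?_
  rintro _ ⟨𝒜, rfl, h𝒜, hunbounded⟩
  choose i hi using fun A : 𝒜 => h𝒜 A.2
  choose f hf using fun A : 𝒜 => (hi A).exists_subset_graphSet (hU (i A)).mem e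
  refine lift_boundingNumber_le f fun ⟨g, hg⟩ => hunbounded ?_
  obtain ⟨ℬ, hℬ, hgℬ⟩ := exists_ctblInf_graphSet_mem he hU g
  exact ⟨ℬ, hℬ, fun A hA => ⟨_, hgℬ (i ⟨A, hA⟩),
    (subsetStar_graphSet he (hg ⟨A, hA⟩)).mono (hf ⟨A, hA⟩) Subset.rfl⟩⟩

theorem cofOmega_le_lift_dominatingNumber :
    cofOmega (setsConvergingTo F) ≤ Cardinal.lift.{u} dominatingNumber := by
  obtain ⟨e, he⟩ := exists_injective_nat X
  choose U hU using fun i => (F i).exists_antitone_basis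
  obtain ⟨D, hDcard, hD⟩ := exists_dominating_family
  choose C hC hgraph using exists_ctblInf_graphSet_mem (F := F) he hU
  refine minCard_le ⟨C '' D, rfl, image_subset_iff.2 fun f _ => hC f, fun ℬ hℬ => ?_⟩
    (hDcard ▸ mk_image_le_lift C D)
  have := hℬ.2.1.to_subtype
  choose i hi using fun B : ℬ => hℬ.1 B.2
  choose f hf using fun B : ℬ => (hi B).exists_subset_graphSet (hU (i B)).mem e
  obtain ⟨g, hg⟩ := exists_leStar_of_countable f
  obtain ⟨d, hdD, hgd⟩ := hD g
  exact ⟨C d, mem_image_of_mem C hdD, fun B hB => ⟨_, hgraph d (i ⟨B, hB⟩),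
    (subsetStar_graphSet he ((hg ⟨B, hB⟩).trans hgd)).mono (hf ⟨B, hB⟩) Subset.rfl⟩⟩

theorem lift_dominatingNumber_le_nonOmega :
    Cardinal.lift.{u} dominatingNumber ≤ nonOmega (setsConvergingTo F) := by
  obtain ⟨e, he⟩ := exists_injective_nat X
  choose U hU using fun i => (F i).exists_antitone_basis
  refine lift_le_minCard dominatingNumber_le_continuum ?_
  rintro _ ⟨𝒜, rfl, h𝒜, hnon⟩
  choose i hi using fun A : 𝒜 => (h𝒜 A.2).2
  choose φ hφ using fun A : 𝒜 =>
    (hi A).exists_leStar_of_inter_graphSet_finite (h𝒜 A.2).1.2.2 he (hU (i A))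
  refine lift_dominatingNumber_le φ fun g => ?_
  obtain ⟨ℬ, hℬ, hgℬ⟩ := exists_ctblInf_graphSet_mem (F := F) he hU (partialSups g)
  obtain ⟨A, hA, hfin⟩ := hnon ℬ hℬ
  exact ⟨⟨A, hA⟩, (LEStar.of_le (le_partialSups g)).trans <|
    hφ ⟨A, hA⟩ _ (partialSups g).monotone (hfin _ (hgℬ (i ⟨A, hA⟩)))⟩

end SetsConvergingTo

/-! ### Copies of the grid `ω × ω` -/

/-- An embedding of the grid `ω × ω` into `X` that carries `{∅} ⊗ FIN` into the ideal `I`, while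
every member of `I` is finite on almost all columns of the copy. -/
structure IsGridEmbedding {X : Type*} (p : ℕ × ℕ → X) (I : Set (Set X)) : Prop where
  injective : Function.Injective p
  image_mem : ∀ A ∈ emptyTensorFin, p '' A ∈ I
  finite_columns : ∀ B ∈ I, ∀ᶠ i in atTop, {j | p (i, j) ∈ B}.Finite

/-- The region of the grid `ω × ω` on and below the graph of `f`. -/
def subgraph (f : ℕ → ℕ) : Set (ℕ × ℕ) :=
  {x | x.2 ≤ f x.1}

theorem subgraph_mem_emptyTensorFin (f : ℕ → ℕ) : subgraph f ∈ emptyTensorFin :=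
  fun i => finite_Iic (f i)

theorem injective_section {X : Type*} {p : ℕ × ℕ → X} (hp : Function.Injective p) (f : ℕ → ℕ) :
    Function.Injective fun i => p (i, f i) :=
  fun _ _ h => congrArg Prod.fst (hp h)

namespace IsGridEmbedding

variable {X : Type u} {p : ℕ × ℕ → X} {I : Set (Set X)}

theorem infinite_ideal (hp : IsGridEmbedding p I) : I.Infinite := by
  refine (infinite_range_of_injective (f := fun k : ℕ => p '' subgraph fun _ => k) ?_).mono
    (range_subset_iff.2 fun k => hp.image_mem _ (subgraph_mem_emptyTensorFin _))
  intro k l hkl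
  have h : subgraph (fun _ => k) = subgraph fun _ => l := hp.injective.image_injective hkl
  exact eq_of_forall_le_iff fun j => Set.ext_iff.1 h (0, j)

theorem exists_column_bound (hp : IsGridEmbedding p I) {B : Set X} (hB : B ∈ I) :
    ∃ g : ℕ → ℕ, ∀ᶠ i in atTop, ∀ j, p (i, j) ∈ B → j ≤ g i := by
  have h : ∀ i, ∃ b, {j | p (i, j) ∈ B}.Finite → ∀ j, p (i, j) ∈ B → j ≤ b := by
    intro i
    by_cases hi : {j | p (i, j) ∈ B}.Finite
    · exact hi.bddAbove.imp fun b hb _ j hj => hb hj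
    · exact ⟨0, fun h => absurd h hi⟩
  choose g hg using h
  exact ⟨g, (hp.finite_columns B hB).mono hg⟩

theorem exists_common_column_bound (hp : IsGridEmbedding p I) {ℬ : Set (Set X)}
    (hℬ : ℬ ∈ ctblInfSubsets I) :
    ∃ g : ℕ → ℕ, ∀ B ∈ ℬ, ∀ᶠ i in atTop, ∀ j, p (i, j) ∈ B → j ≤ g i := by
  have := hℬ.2.1.to_subtype
  choose f hf using fun B : ℬ => hp.exists_column_bound (hℬ.1 B.2)
  obtain ⟨g, hg⟩ := exists_leStar_of_countable f
  refine ⟨g, fun B hB => ?_⟩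
  filter_upwards [hf ⟨B, hB⟩, leStar_iff_eventually_le.1 (hg ⟨B, hB⟩)] with i hi hfg j hj
  exact (hi j hj).trans hfg

theorem leStar_of_image_subsetStar (hp : Function.Injective p) {B : Set X} {f g : ℕ → ℕ}
    (hg : ∀ᶠ i in atTop, ∀ j, p (i, j) ∈ B → j ≤ g i) (hB : SubsetStar (p '' subgraph f) B) :
    LEStar f g := by
  have hfB : ∀ᶠ i in atTop, p (i, f i) ∈ B := by
    rw [← Nat.cofinite_eq_atTop]
    exact (hB.preimage (injective_section hp f).injOn).subset fun i hi =>
      ⟨mem_image_of_mem p (le_refl (f i)), hi⟩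
  exact leStar_iff_eventually_le.2 ((hg.and hfB).mono fun i hi => hi.1 _ hi.2)

theorem addOmega_le (hp : IsGridEmbedding p I) :
    addOmega I ≤ Cardinal.lift.{u} boundingNumber := by
  obtain ⟨F, hFcard, hF⟩ := exists_unbounded_family
  refine minCard_le ⟨(fun f => p '' subgraph f) '' F, rfl,
    image_subset_iff.2 fun f _ => hp.image_mem _ (subgraph_mem_emptyTensorFin f), ?_⟩
    (hFcard ▸ mk_image_le_lift _ F)
  rintro ⟨ℬ, hℬ, hcover⟩
  obtain ⟨g, hg⟩ := hp.exists_common_column_bound hℬ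
  refine hF ⟨g, fun f hf => ?_⟩
  obtain ⟨B, hB, hfB⟩ := hcover _ (mem_image_of_mem _ hf)
  exact leStar_of_image_subsetStar hp.injective (hg B hB) hfB

theorem lift_dominatingNumber_le_cofOmega (hp : IsGridEmbedding p I) :
    Cardinal.lift.{u} dominatingNumber ≤ cofOmega I := by
  refine lift_le_minCard dominatingNumber_le_continuum ?_
  rintro _ ⟨𝒜, rfl, h𝒜, hcof⟩
  choose φ hφ using fun C : 𝒜 => hp.exists_common_column_bound (h𝒜 C.2)
  refine lift_dominatingNumber_le φ fun g => ?_
  obtain ⟨ℬ, hℬ, hgℬ⟩ := exists_ctblInf_superset hp.infinite_ideal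
    (singleton_subset_iff.2 (hp.image_mem _ (subgraph_mem_emptyTensorFin g)))
    (countable_singleton _)
  obtain ⟨C, hC, hℬC⟩ := hcof ℬ hℬ
  obtain ⟨A, hA, hgA⟩ := hℬC _ (hgℬ rfl)
  exact ⟨⟨C, hC⟩, leStar_of_image_subsetStar hp.injective (hφ ⟨C, hC⟩ A hA) hgA⟩

theorem range_section_mem (hp : IsGridEmbedding p I) (f : ℕ → ℕ) :
    (range fun i => p (i, f i)) ∈ I := by
  rw [range_comp' p fun i => (i, f i)]
  refine hp.image_mem _ fun i => (finite_singleton (f i)).subset ?_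
  rintro j ⟨k, hk⟩
  obtain ⟨rfl, rfl⟩ := Prod.mk.inj hk
  rfl

theorem nonOmega_le (hp : IsGridEmbedding p I) :
    nonOmega I ≤ Cardinal.lift.{u} dominatingNumber := by
  obtain ⟨D, hDcard, hD⟩ := exists_dominating_family
  let G (f : ℕ → ℕ) : Set X := range fun i => p (i, f i + 1)
  have hG : ∀ f, G f ∈ ctblInfSubsets univ ∩ I := fun f =>
    ⟨⟨subset_univ _, countable_range _,
      infinite_range_of_injective (injective_section hp.injective fun i => f i + 1)⟩,
      hp.range_section_mem fun i => f i + 1⟩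
  refine minCard_le ⟨G '' D, rfl, image_subset_iff.2 fun f _ => hG f, fun ℬ hℬ => ?_⟩
    (hDcard ▸ mk_image_le_lift G D)
  obtain ⟨g, hg⟩ := hp.exists_common_column_bound hℬ
  obtain ⟨f, hfD, hgf⟩ := hD g
  refine ⟨G f, mem_image_of_mem G hfD, fun B hB => ?_⟩
  have hfB : ∀ᶠ i in cofinite, p (i, f i + 1) ∉ B := by
    rw [Nat.cofinite_eq_atTop]
    filter_upwards [hg B hB, leStar_iff_eventually_le.1 hgf] with i hi hgfi hmem
    exact Nat.not_succ_le_self _ ((hi _ hmem).trans hgfi)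
  refine ((eventually_cofinite.1 hfB).image fun i => p (i, f i + 1)).subset ?_
  rintro _ ⟨⟨i, rfl⟩, hi⟩
  exact mem_image_of_mem _ (not_not.2 hi)

end IsGridEmbedding

theorem omega_invariants_eq_of_isGridEmbedding {X : Type u} [Countable X] {ι : Type*} [Countable ι]
    {F : ι → Filter X} [∀ i, (F i).IsCountablyGenerated] {p : ℕ × ℕ → X}
    (hp : IsGridEmbedding p (setsConvergingTo F)) :
    addOmega (setsConvergingTo F) = Cardinal.lift.{u} boundingNumber ∧
      cofOmega (setsConvergingTo F) = Cardinal.lift.{u} dominatingNumber ∧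
      nonOmega (setsConvergingTo F) = Cardinal.lift.{u} dominatingNumber := by
  have : Infinite X := .of_injective p hp.injective
  have : Nonempty ι := (hp.range_section_mem 0).nonempty
  exact ⟨hp.addOmega_le.antisymm lift_boundingNumber_le_addOmega,
    cofOmega_le_lift_dominatingNumber.antisymm hp.lift_dominatingNumber_le_cofOmega,
    hp.nonOmega_le.antisymm lift_dominatingNumber_le_nonOmega⟩

/-! ### The ideal `{∅} ⊗ FIN` -/

theorem emptyTensorFin_eq_setsConvergingTo :
    emptyTensorFin = setsConvergingTo fun _ : Unit => comap Prod.fst (atTop : Filter ℕ) := by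
  ext A
  have hcolumn : ∀ i, A ∩ Prod.fst ⁻¹' {i} = Prod.mk i '' {j | (i, j) ∈ A} := by
    intro i
    ext ⟨k, j⟩
    aesop
  calc A ∈ emptyTensorFin
    _ ↔ ∀ i, (A ∩ Prod.fst ⁻¹' {i}).Finite := forall_congr' fun i => by
      rw [hcolumn, finite_image_iff (Prod.mk_right_injective i).injOn]
    _ ↔ ∀ i, {i}ᶜ ∈ map Prod.fst (cofinite ⊓ 𝓟 A) := forall_congr' fun i => by
      rw [mem_map, mem_inf_principal', mem_cofinite, compl_union, compl_compl, preimage_compl,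
        compl_compl]
    _ ↔ SetConvergesTo A (comap Prod.fst atTop) := by
      rw [SetConvergesTo, ← map_le_iff_le_comap, ← Nat.cofinite_eq_atTop,
        le_cofinite_iff_compl_singleton_mem]
    _ ↔ A ∈ setsConvergingTo fun _ : Unit => comap Prod.fst (atTop : Filter ℕ) :=
      (exists_const Unit).symm

theorem isGridEmbedding_id : IsGridEmbedding id emptyTensorFin where
  injective := Function.injective_id
  image_mem A hA := by rwa [image_id]
  finite_columns B hB := .of_forall hB

theorem omega_invariants_emptyTensorFin :
    addOmega emptyTensorFin = boundingNumber ∧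
      cofOmega emptyTensorFin = dominatingNumber ∧
      nonOmega emptyTensorFin = dominatingNumber := by
  have h := isGridEmbedding_id
  rw [emptyTensorFin_eq_setsConvergingTo] at h ⊢
  simpa only [Cardinal.lift_uzero] using omega_invariants_eq_of_isGridEmbedding h

/-! ### Convergence ideals of countable spaces -/

section ConvIdeal

variable {X : Type u} [TopologicalSpace X]

instance isCountablyGenerated_nhdsSet_finset [FirstCountableTopology X] (T : Finset X) :
    (𝓝ˢ (T : Set X)).IsCountablyGenerated := by
  classical
  induction T using Finset.induction_on with
  | empty => simpa only [Finset.coe_empty, nhdsSet_empty] using isCountablyGenerated_bot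
  | insert x T _ ih =>
    rw [Finset.coe_insert, nhdsSet_insert]
    infer_instance

theorem disjoint_nhds_nhdsSet_finset [T2Space X] {x : X} {T : Finset X} (hx : x ∉ T) :
    Disjoint (𝓝 x) (𝓝ˢ (T : Set X)) := by
  rw [← nhdsSet_singleton, ← separatedNhds_iff_disjoint]
  exact .of_singleton_finset hx

theorem mem_convIdeal_univ_of_finite {κ : Type*} [Finite κ] {A : Set X} (d : κ → ℕ → X)
    (hd : ∀ i, ∃ x, Tendsto (d i) atTop (𝓝 x)) (hA : A ⊆ ⋃ i, range (d i)) :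
    A ∈ convIdeal (univ : Set X) := by
  obtain ⟨k, ⟨σ⟩⟩ := Finite.exists_equiv_fin κ
  refine ⟨subset_univ A, k, d ∘ σ.symm, fun _ _ => mem_univ _, fun i => hd (σ.symm i), ?_⟩
  exact hA.trans (σ.symm.surjective.iUnion_comp fun i => range (d i)).ge

theorem union_mem_convIdeal_univ {A B : Set X} (hA : A ∈ convIdeal univ)
    (hB : B ∈ convIdeal univ) : A ∪ B ∈ convIdeal (univ : Set X) := by
  obtain ⟨-, k, c, -, hc, hAc⟩ := hA
  obtain ⟨-, l, d, -, hd, hBd⟩ := hB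
  refine mem_convIdeal_univ_of_finite (Sum.elim c d) (Sum.forall.2 ⟨hc, hd⟩) ?_
  rw [iUnion_sum]
  exact union_subset_union hAc hBd

theorem SetConvergesTo.exists_tendsto {A : Set X} {x : X} (hA : SetConvergesTo A (𝓝 x))
    (hc : A.Countable) : ∃ d : ℕ → X, Tendsto d atTop (𝓝 x) ∧ A ⊆ range d := by
  have := hc.to_subtype
  obtain ⟨e, he⟩ := exists_injective_nat A
  refine ⟨Function.extend e Subtype.val fun _ => x, ?_,
    fun a ha => ⟨e ⟨a, ha⟩, he.extend_apply ..⟩⟩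
  rw [← Nat.cofinite_eq_atTop]
  intro U hU
  have hfin : (Subtype.val ⁻¹' (A \ U) : Set A).Finite :=
    (setConvergesTo_iff.1 hA U hU).preimage Subtype.val_injective.injOn
  refine mem_map.2 (mem_cofinite.2 ((hfin.image e).subset fun n hn => ?_))
  by_cases h : n ∈ range e
  · obtain ⟨a, rfl⟩ := h
    rw [mem_compl_iff, mem_preimage, he.extend_apply] at hn
    exact mem_image_of_mem e ⟨a.2, hn⟩
  · rw [mem_compl_iff, mem_preimage, Function.extend_apply' _ _ _ h] at hn
    exact absurd (mem_of_mem_nhds hU) hn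

theorem SetConvergesTo.mem_convIdeal_univ [Countable X] [T2Space X] {A : Set X} {T : Finset X}
    (hA : SetConvergesTo A (𝓝ˢ (T : Set X))) : A ∈ convIdeal (univ : Set X) := by
  classical
  induction T using Finset.induction_on generalizing A with
  | empty =>
    have hfin : A.Finite := by simpa using setConvergesTo_iff.1 hA ∅ (by simp)
    have := hfin.to_subtype
    refine mem_convIdeal_univ_of_finite (fun (a : A) _ => a) (fun a => ⟨a, tendsto_const_nhds⟩) ?_
    exact fun a ha => mem_iUnion.2 ⟨⟨a, ha⟩, 0, rfl⟩
  | insert x T hxT ih =>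
    rw [Finset.coe_insert, nhdsSet_insert] at hA
    obtain ⟨B, C, rfl, hB, hC⟩ := hA.exists_eq_union (disjoint_nhds_nhdsSet_finset hxT)
    obtain ⟨d, hd, hBd⟩ := hB.exists_tendsto (to_countable B)
    refine union_mem_convIdeal_univ ?_ (ih hC)
    have hBd' : B ⊆ ⋃ _ : Unit, range d := by rwa [iUnion_const]
    exact mem_convIdeal_univ_of_finite (fun _ : Unit => d) (fun _ => ⟨x, hd⟩) hBd'

theorem exists_setConvergesTo_of_mem_convIdeal {D A : Set X} (hA : A ∈ convIdeal D) :
    ∃ T : Finset X, SetConvergesTo A (𝓝ˢ (T : Set X)) := by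
  classical
  obtain ⟨-, k, d, -, hd, hAd⟩ := hA
  choose x hx using hd
  refine ⟨Finset.univ.image x, setConvergesTo_iff.2 fun U hU => ?_⟩
  refine (finite_iUnion fun i => setConvergesTo_iff.1 (setConvergesTo_range (hx i)) U ?_).subset
    (iUnion_sdiff U (fun i => range (d i)) ▸ sdiff_subset_sdiff_left hAd)
  exact nhds_le_nhdsSet (by simp) hU

theorem convIdeal_univ_eq_setsConvergingTo [Countable X] [T2Space X] :
    convIdeal (univ : Set X) = setsConvergingTo fun T : Finset X => 𝓝ˢ (T : Set X) :=
  Subset.antisymm (fun _ => exists_setConvergesTo_of_mem_convIdeal)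
    fun _ ⟨_, hA⟩ => hA.mem_convIdeal_univ

theorem isGridEmbedding_of_setConvergesTo [T2Space X] {p : ℕ × ℕ → X}
    (hp : Function.Injective p) {q : ℕ → X} (hq : Function.Injective q)
    (hpq : ∀ i, SetConvergesTo (range fun j => p (i, j)) (𝓝 (q i))) {z : X}
    (hz : Tendsto p (comap Prod.fst atTop) (𝓝 z)) :
    IsGridEmbedding p (setsConvergingTo fun T : Finset X => 𝓝ˢ (T : Set X)) where
  injective := hp
  image_mem A hA := by
    rw [emptyTensorFin_eq_setsConvergingTo] at hA
    obtain ⟨_, hA⟩ := hA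
    refine ⟨{z}, ?_⟩
    simpa only [Finset.coe_singleton, nhdsSet_singleton] using hA.image hz
  finite_columns := by
    rintro B ⟨T, hB⟩
    have hqT : ∀ᶠ i in atTop, q i ∉ T := by
      rw [← Nat.cofinite_eq_atTop]
      exact hq.tendsto_cofinite.eventually T.finite_toSet.compl_mem_cofinite
    filter_upwards [hqT] with i hi
    have hcolumn := (hpq i).inter_finite hB (disjoint_nhds_nhdsSet_finset hi)
    refine (hcolumn.preimage (hp.comp (Prod.mk_right_injective i)).injOn).subset fun j hj => ?_
    exact ⟨mem_range_self j, hj⟩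

theorem exists_injective_grid {X : Type*} {C : ℕ → Set X} (hC : ∀ i, (C i).Infinite)
    (hfin : Pairwise fun i k => (C i ∩ C k).Finite) :
    ∃ p : ℕ × ℕ → X, Function.Injective p ∧ ∀ i j, p (i, j) ∈ C i := by
  have hD : ∀ i, (disjointed C i).Infinite := by
    intro i hDi
    have hinter : (C i ∩ ⋃ k < i, C k).Finite := by
      rw [inter_iUnion₂]
      exact (finite_Iio i).biUnion fun k hk => hfin hk.ne'
    rw [disjointed_eq_inter_compl, ← compl_iUnion₂, ← sdiff_eq] at hDi
    exact hC i (inter_union_sdiff (C i) _ ▸ hinter.union hDi)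
  refine ⟨fun x => (hD x.1).natEmbedding _ x.2, ?_,
    fun i j => disjointed_subset C i ((hD i).natEmbedding _ j).2⟩
  rintro ⟨i, j⟩ ⟨k, l⟩ h
  obtain rfl : i = k := by
    by_contra hik
    refine disjoint_left.1 (disjoint_disjointed C hik) ((hD i).natEmbedding _ j).2 ?_
    exact mem_of_eq_of_mem h ((hD k).natEmbedding _ l).2
  exact congrArg (Prod.mk i) (((hD i).natEmbedding _).injective (Subtype.ext h))

theorem exists_infinite_setConvergesTo_of_mem_derivedSet [FirstCountableTopology X] [T1Space X]
    {s U : Set X} {z : X} (hz : z ∈ derivedSet s) (hU : U ∈ 𝓝 z) :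
    ∃ A ⊆ s ∩ U, A.Infinite ∧ SetConvergesTo A (𝓝 z) := by
  have hne : (𝓝[≠] z ⊓ 𝓟 s).NeBot := hz
  have hle : 𝓝[≠] z ⊓ 𝓟 s ≤ 𝓝 z := inf_le_left.trans nhdsWithin_le_nhds
  obtain ⟨A, hA, hinf, hconv⟩ := exists_infinite_setConvergesTo
    (F := 𝓝[≠] z ⊓ 𝓟 s) (inf_le_left.trans (nhdsNE_le_cofinite z))
    (inter_mem (mem_inf_of_right (mem_principal_self s)) (hle hU))
  exact ⟨A, hA, hinf, hconv.mono_right hle⟩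

theorem exists_injective_seq_of_mem_derivedSet [FirstCountableTopology X] [T1Space X]
    {s : Set X} {z : X} (hz : z ∈ derivedSet s) {U : ℕ → Set X} (hU : ∀ i, U i ∈ 𝓝 z) :
    ∃ q : ℕ → X, Function.Injective q ∧ ∀ i, q i ∈ s ∩ U i := by
  obtain ⟨A, hA, hinf, hconv⟩ := exists_infinite_setConvergesTo_of_mem_derivedSet hz univ_mem
  let u : ℕ → X := fun n => hinf.natEmbedding A n
  have hu : Function.Injective u := Subtype.val_injective.comp (hinf.natEmbedding A).injective
  have hlim : Tendsto u atTop (𝓝 z) :=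
    Nat.cofinite_eq_atTop ▸ hconv.tendsto hu fun n => (hinf.natEmbedding A n).2
  obtain ⟨φ, hφ, hφU⟩ := extraction_forall_of_eventually fun i => hlim.eventually (hU i)
  exact ⟨u ∘ φ, hu.comp hφ.injective,
    fun i => ⟨(hA (hinf.natEmbedding A (φ i)).2).1, hφU i⟩⟩

theorem exists_isGridEmbedding [FirstCountableTopology X] [T2Space X] {z : X}
    (hz : z ∈ derivedSet (derivedSet (univ : Set X))) :
    ∃ p, IsGridEmbedding p (setsConvergingTo fun T : Finset X => 𝓝ˢ (T : Set X)) := by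
  obtain ⟨U, hUopen, hU⟩ := (nhds_basis_opens z).exists_antitone_subbasis
  obtain ⟨q, hq, hqU⟩ := exists_injective_seq_of_mem_derivedSet hz hU.mem
  have hcolumn : ∀ i, ∃ C ⊆ univ ∩ U i, C.Infinite ∧ SetConvergesTo C (𝓝 (q i)) := fun i =>
    exists_infinite_setConvergesTo_of_mem_derivedSet (hqU i).1
      ((hUopen i).2.mem_nhds (hqU i).2)
  choose C hCU hCinf hCq using hcolumn
  obtain ⟨p, hp, hpC⟩ := exists_injective_grid hCinf fun i k hik =>
    (hCq i).inter_finite (hCq k) (disjoint_nhds_nhds.2 (hq.ne hik))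
  refine ⟨p, isGridEmbedding_of_setConvergesTo hp hq
    (fun i => (hCq i).mono (range_subset_iff.2 (hpC i))) (hU.1.tendsto_right_iff.2 fun i _ => ?_)⟩
  exact mem_comap.2 ⟨Ici i, Ici_mem_atTop i, fun x hx => hU.antitone hx (hCU x.1 (hpC x.1 x.2)).2⟩

theorem omega_invariants_convIdeal [Countable X] [FirstCountableTopology X] [T2Space X]
    (hX : (derivedSet (derivedSet (univ : Set X))).Nonempty) :
    addOmega (convIdeal (univ : Set X)) = Cardinal.lift.{u} boundingNumber ∧
      cofOmega (convIdeal (univ : Set X)) = Cardinal.lift.{u} dominatingNumber ∧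
      nonOmega (convIdeal (univ : Set X)) = Cardinal.lift.{u} dominatingNumber := by
  obtain ⟨z, hz⟩ := hX
  obtain ⟨p, hp⟩ := exists_isGridEmbedding hz
  rw [convIdeal_univ_eq_setsConvergingTo]
  exact omega_invariants_eq_of_isGridEmbedding hp

end ConvIdeal

/-! ### The spaces `ω ^ α + 1` -/

theorem preimage_derivedSet_of_isOpenEmbedding {X Y : Type*} [TopologicalSpace X]
    [TopologicalSpace Y] {f : X → Y} (hf : IsOpenEmbedding f) (s : Set Y) :
    f ⁻¹' derivedSet s = derivedSet (f ⁻¹' s) := by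
  ext x
  rw [mem_preimage, mem_derivedSet, mem_derivedSet, ← comap_principal, hf.accPt_comap_iff]

theorem mem_derivedSet_univ_of_isSuccLimit {a : Ordinal.{u}} (ha : Order.IsSuccLimit a) :
    a ∈ derivedSet univ :=
  SuccOrder.accPt_principal.2
    ⟨ha.not_isMin, fun b hb => ⟨Order.succ b, mem_univ _, Order.lt_succ b, ha.succ_lt hb⟩⟩

theorem mul_mem_derivedSet_derivedSet_univ {a b : Ordinal.{u}} (ha : Order.IsSuccLimit a)
    (hb : Order.IsSuccLimit b) : a * b ∈ derivedSet (derivedSet univ) := by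
  have ha₀ : 0 < a := ha.pos
  have hab : Order.IsSuccLimit (a * b) := Ordinal.isSuccLimit_mul_left ha hb.pos
  refine SuccOrder.accPt_principal.2 ⟨hab.not_isMin, fun c hc => ?_⟩
  obtain ⟨d, hdb, hcd⟩ := (Ordinal.lt_mul_iff_of_isSuccLimit hb).1 hc
  have hd : 0 < d := pos_iff_ne_zero.2 (by rintro rfl; simp at hcd)
  exact ⟨a * d, mem_derivedSet_univ_of_isSuccLimit (Ordinal.isSuccLimit_mul_left ha hd), hcd,
    mul_lt_mul_of_pos_left hdb ha₀⟩

theorem derivedSet_derivedSet_omegaPowSucc_nonempty {α : Ordinal.{0}} (hα : 2 ≤ α) :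
    (derivedSet (derivedSet (univ : Set (OmegaPowSucc α)))).Nonempty := by
  have hopen : IsOpen (Iic ((ω : Ordinal.{0}) ^ α)) := Order.Iio_succ (ω ^ α) ▸ isOpen_Iio
  have hω : (ω : Ordinal.{0}) * ω ≤ ω ^ α := by
    rw [← Ordinal.opow_one ω, ← Ordinal.opow_add, one_add_one_eq_two, Ordinal.opow_one]
    exact Ordinal.opow_le_opow_right Ordinal.omega0_pos hα
  refine ⟨⟨ω * ω, hω⟩, ?_⟩
  rw [← preimage_univ (f := ((↑) : OmegaPowSucc α → Ordinal)),
    ← preimage_derivedSet_of_isOpenEmbedding hopen.isOpenEmbedding_subtypeVal,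
    ← preimage_derivedSet_of_isOpenEmbedding hopen.isOpenEmbedding_subtypeVal]
  exact mul_mem_derivedSet_derivedSet_univ Ordinal.isSuccLimit_omega0 Ordinal.isSuccLimit_omega0

theorem countable_Iic_of_lt_omega_one {a : Ordinal.{u}} (ha : a < ω₁) : Countable (Iic a) := by
  have hcard : a.card ≤ ℵ₀ := Cardinal.lt_aleph_one_iff.1 (Cardinal.lt_omega_iff_card_lt.1 ha)
  have hc : (Iio a).Countable := by
    rw [← Cardinal.le_aleph0_iff_set_countable, Cardinal.mk_Iio_ordinal]
    exact Cardinal.lift_le_aleph0.2 hcard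
  rw [← Iio_insert]
  exact (hc.insert _).to_subtype

theorem countable_omegaPowSucc {α : Ordinal.{0}} (hα : α < ω₁) : Countable (OmegaPowSucc α) :=
  countable_Iic_of_lt_omega_one (Ordinal.isPrincipal_opow_omega 1 Ordinal.omega0_lt_omega_one hα)

theorem mainTheorem4_general :
    (addOmega emptyTensorFin = boundingNumber ∧
      cofOmega emptyTensorFin = dominatingNumber ∧
      nonOmega emptyTensorFin = dominatingNumber) ∧
    ∀ (X : Type u) [TopologicalSpace X] [Countable X] [FirstCountableTopology X] [T2Space X],
      (derivedSet (derivedSet (univ : Set X))).Nonempty →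
      addOmega (convIdeal (univ : Set X)) = Cardinal.lift.{u} boundingNumber ∧
      cofOmega (convIdeal (univ : Set X)) = Cardinal.lift.{u} dominatingNumber ∧
      nonOmega (convIdeal (univ : Set X)) = Cardinal.lift.{u} dominatingNumber :=
  ⟨omega_invariants_emptyTensorFin, fun _ _ _ _ _ => omega_invariants_convIdeal⟩

theorem mainTheorem4 :
    (addOmega emptyTensorFin = boundingNumber ∧
      cofOmega emptyTensorFin = dominatingNumber ∧
      nonOmega emptyTensorFin = dominatingNumber) ∧
    ∀ α : Ordinal.{0}, 2 ≤ α → α < ω₁ →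
      addOmega (convAlpha α) = Cardinal.lift.{1} boundingNumber ∧
      cofOmega (convAlpha α) = Cardinal.lift.{1} dominatingNumber ∧
      nonOmega (convAlpha α) = Cardinal.lift.{1} dominatingNumber := by
  refine ⟨mainTheorem4_general.{0}.1, fun α hα hα₁ => ?_⟩
  have := countable_omegaPowSucc hα₁
  exact mainTheorem4_general.2 (OmegaPowSucc α) (derivedSet_derivedSet_omegaPowSucc_nonempty hα)
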